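/- All manifolds and maps are smooth and all actions are from the left. Let $G$ be a Lie group with Lie algebra $\mathfrak g$, let $V$ be a finite-dimensional smooth representation of $G$, and let $(G,\omega,V)$ be a Pfaffian group, that is, a Pfaffian groupoid over the point, not necessarily full: $\omega\in\Omega^1(G,V)$ has constant rank and involutive kernel and is multiplicative, $\omega_{gh}(dm(v,w))=\omega_g(v)+g\cdot\omega_h(w)$ for $v\in T_gG$, $w\in T_hG$, where $m$ is the multiplication. Put $l:=\omega_e:\mathfrak g\to V$ and $\mathfrak h:=\ker l$, and write $(G,\mathfrak h,V)$ for this Pfaffian group. A principal $G$-bundle over a manifold $M$ is a manifold $P$ with a smooth free proper action $m_P:G\times P\to P$ and a $G$-invariant surjective submersion $\pi:P\to M$ on whose fibres $G$ acts transitively. For $\alpha\in\mathfrak g$ let $\alpha^\dagger_p:=d(g\mapsto g\cdot p)_e(\alpha)\in T_pP$. A subspace of $T_pP$ is called vertical if it lies in $\ker(d\pi)_p$; a foliation is identified with its tangent distribution (an involutive subbundle of $TP$), and its normal bundle is $\nu_{\mathcal F}=TP/T\mathcal F$. A full principal Pfaffian $(G,\mathfrak h,V)$-bundle (Cartan bundle)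 over $M$ is a principal $G$-bundle $P$ over $M$ with a pointwise surjective form $\theta\in\Omega^1(P,V)$ such that $$\theta_{g\cdot p}(dm_P(v,w))=\omega_g(v)+g\cdot\theta_p(w)\qquad (v\in T_gG,\ w\in T_pP)$$ and $\ker(d\mu)\cap\ker\theta=\ker(d\pi)\cap\ker\theta$, where $\mu:P\to\{\ast\}$ is the moment map (so $\ker\theta\subset\ker d\pi$). Then the following hold. (1) A full principal Pfaffian $(G,\mathfrak h,V)$-bundle over $M$ is equivalent to the datum of a principal $G$-bundle $P$ over $M$ together with a $G$-equivariant vertical foliation $\mathcal F$ on $P$ and an isomorphism of $G$-equivariant vector bundles $\Phi:\nu_{\mathcal F}\to P\times V$ over $P$ with $\Phi([\alpha^\dagger_p])=(p,l(\alpha))$ for all $\alpha\in\mathfrak g$, $p\in P$. Precisely: on every principal $G$-bundle $P$ over $M$, the rules $T\mathcal F=\ker\theta$ and $\Phi([v])=(p,\theta_p(v))$ for $v\in T_pP$ define a bijection between the forms $\theta$ as above and the pairs $(\mathcal F,\Phi)$; and a morphism $\Psi$ of principal $G$-bundles over $M$ satisfies $\Psi^*\theta'=\theta$ if and only if $d\Psi(T\mathcal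 F)\subset T\mathcal F'$ and $\Psi$ intertwines $\Phi$ and $\Phi'$. (2) Alternatively, a full principal Pfaffian $(G,\mathfrak h,V)$-bundle over $M$ is equivalent to the datum of a principal $G$-bundle $P$ over $M$ together with a pointwise surjective $G$-equivariant form $\theta\in\Omega^1(P,V)$ whose kernel is involutive and vertical and which satisfies $\theta(\alpha^\dagger_p)=l(\alpha)$ for all $\alpha\in\mathfrak g$, $p\in P$; the equivalence keeps $P$, $\theta$ and the form-preserving morphisms of principal $G$-bundles. -/

import Mathlib

open scoped Manifold ContDiff

noncomputable section

namespace Pfaffian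

universe u v

section General

variable {E : Type*} [NormedAddCommGroup E] [NormedSpace ℝ E]
  {X : Type*} [TopologicalSpace X] [ChartedSpace E X]
  {V : Type*} [NormedAddCommGroup V] [NormedSpace ℝ V]

/-- A `V`-valued one-form on `X` is smooth if it is smooth as a map `TX → V`. -/
def IsSmoothForm [IsManifold 𝓘(ℝ, E) ∞ X]
    (θ : ∀ x : X, TangentSpace 𝓘(ℝ, E) x →L[ℝ] V) : Prop :=
  ContMDiff 𝓘(ℝ, E).tangent 𝓘(ℝ, V) ∞
    (fun w : TangentBundle 𝓘(ℝ, E) X => (θ w.proj w.snd : V))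

/-- The vector field `Y` is smooth on the set `U`. -/
def IsSmoothFieldOn [IsManifold 𝓘(ℝ, E) ∞ X]
    (Y : ∀ x : X, TangentSpace 𝓘(ℝ, E) x) (U : Set X) : Prop :=
  ContMDiffOn 𝓘(ℝ, E) 𝓘(ℝ, E).tangent ∞
    (fun x => (⟨x, Y x⟩ : TangentBundle 𝓘(ℝ, E) X)) U

/-- A family of tangent subspaces is a (regular, smooth) distribution, that is, a vector subbundle
of the tangent bundle: it has local frames of constant length. -/
def IsRegularDistribution [IsManifold 𝓘(ℝ, E) ∞ X]
    (D : ∀ x : X, Submodule ℝ (TangentSpace 𝓘(ℝ, E) x)) : Prop :=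
  ∃ k : ℕ, ∀ x : X, ∃ U : Set X, IsOpen U ∧ x ∈ U ∧
    ∃ Y : Fin k → ∀ y : X, TangentSpace 𝓘(ℝ, E) y,
      (∀ i, IsSmoothFieldOn (Y i) U) ∧
      ∀ y ∈ U, LinearIndependent ℝ (fun i => Y i y) ∧
        Submodule.span ℝ (Set.range fun i => Y i y) = D y

/-- Involutivity: the bracket of two (locally defined) smooth vector fields tangent to `D` is
tangent to `D`. -/
def IsInvolutive [IsManifold 𝓘(ℝ, E) ∞ X]
    (D : ∀ x : X, Submodule ℝ (TangentSpace 𝓘(ℝ, E) x)) : Prop :=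
  ∀ (U : Set X), IsOpen U → ∀ Y Z : ∀ x : X, TangentSpace 𝓘(ℝ, E) x,
    IsSmoothFieldOn Y U → IsSmoothFieldOn Z U →
    (∀ x ∈ U, Y x ∈ D x) → (∀ x ∈ U, Z x ∈ D x) →
    ∀ x ∈ U, VectorField.mlieBracket 𝓘(ℝ, E) Y Z x ∈ D x

variable (E X) in
/-- A foliation, given by its tangent distribution: an involutive subbundle of the tangent
bundle. -/
structure Foliation [IsManifold 𝓘(ℝ, E) ∞ X] where
  /-- The tangent space to the leaf through each point. -/
  tangent : ∀ x : X, Submodule ℝ (TangentSpace 𝓘(ℝ, E) x)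
  regular : IsRegularDistribution tangent
  involutive : IsInvolutive tangent

/-- The kernel of the differential at `x` of the map from `X` to the one-point manifold. For a
group, seen as a groupoid over the point, this map is both the source and the target; for a
principal bundle of a group it is the moment map. -/
def kerToPoint (x : X) : Submodule ℝ (TangentSpace 𝓘(ℝ, E) x) :=
  (mfderiv 𝓘(ℝ, E) 𝓘(ℝ, PUnit.{1}) (fun _ : X => PUnit.unit) x).ker

end General

section Group

variable (EG : Type*) [NormedAddCommGroup EG] [NormedSpace ℝ EG]
  (G : Type*) [Group G] [TopologicalSpace G] [ChartedSpace EG G] [LieGroup 𝓘(ℝ, EG) ∞ G]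
  (V : Type*) [NormedAddCommGroup V] [NormedSpace ℝ V]

/-- A Pfaffian group `(G, ω, V)`: a Pfaffian groupoid over the point with arrow space the Lie group
`G`. The condition that `ker ω` meets the kernels of the differentials of the source and of the
target in the same subbundle is void, since source and target coincide. The Pfaffian group is not
required to be full, i.e. `ω` need not be surjective. -/
structure PfaffianGroup where
  /-- The representation of `G` on `V`. -/
  ρ : Representation ℝ G V
  smooth_ρ : ContMDiff (𝓘(ℝ, EG).prod 𝓘(ℝ, V)) 𝓘(ℝ, V) ∞ (fun x : G × V => ρ x.1 x.2)
  /-- The Pfaffian form `ω`. -/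
  form : ∀ g : G, TangentSpace 𝓘(ℝ, EG) g →L[ℝ] V
  smooth_form : IsSmoothForm form
  multiplicative : ∀ (g h : G) (v : TangentSpace 𝓘(ℝ, EG) g) (w : TangentSpace 𝓘(ℝ, EG) h),
    form (g * h) (mfderiv (𝓘(ℝ, EG).prod 𝓘(ℝ, EG)) 𝓘(ℝ, EG) (fun x : G × G => x.1 * x.2) (g, h)
      ((v, w) : EG × EG)) = form g v + ρ g (form h w)
  constant_rank : ∃ r : ℕ, ∀ g, Module.finrank ℝ (form g).range = r
  source_transversal : ∀ g, (form g).ker ⊔ kerToPoint g = ⊤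
  symbol_involutive : IsInvolutive fun g => (form g).ker ⊓ kerToPoint g

end Group

section Bundle

variable (EG : Type*) [NormedAddCommGroup EG] [NormedSpace ℝ EG]
  (G : Type*) [Group G] [TopologicalSpace G] [ChartedSpace EG G]
  (EM : Type*) [NormedAddCommGroup EM] [NormedSpace ℝ EM]
  (M : Type*) [TopologicalSpace M] [ChartedSpace EM M]

/-- A (left) principal `G`-bundle over `M`: a Hausdorff finite-dimensional manifold with a smooth,
free and proper action of `G`, and an invariant surjective submersion to `M` on whose fibres the
action is transitive. -/
structure PrincipalBundle where
  /-- The model vector space of the total space. -/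
  E : Type u
  [normedE : NormedAddCommGroup E]
  [normedSpaceE : NormedSpace ℝ E]
  [finiteE : FiniteDimensional ℝ E]
  /-- The total space. -/
  carrier : Type v
  [topology : TopologicalSpace carrier]
  [charted : ChartedSpace E carrier]
  [manifold : IsManifold 𝓘(ℝ, E) ∞ carrier]
  [hausdorff : T2Space carrier]
  [action : MulAction G carrier]
  [smooth_action : ContMDiffSMul 𝓘(ℝ, EG) 𝓘(ℝ, E) ∞ G carrier]
  [proper : ProperSMul G carrier]
  free : ∀ (g : G) (p : carrier), g • p = p → g = 1
  /-- The projection to the base. -/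
  π : carrier → M
  surjective_π : Function.Surjective π
  submersion_π : Manifold.IsSubmersion 𝓘(ℝ, E) 𝓘(ℝ, EM) ∞ π
  invariant_π : ∀ (g : G) (p : carrier), π (g • p) = π p
  transitive : ∀ p q : carrier, π p = π q → ∃ g : G, q = g • p

attribute [instance] PrincipalBundle.normedE PrincipalBundle.normedSpaceE PrincipalBundle.finiteE
  PrincipalBundle.topology PrincipalBundle.charted PrincipalBundle.manifold
  PrincipalBundle.hausdorff PrincipalBundle.action PrincipalBundle.smooth_action
  PrincipalBundle.proper

instance : CoeSort (PrincipalBundle.{u, v} EG G EM M) (Type v) := ⟨PrincipalBundle.carrier⟩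

end Bundle

namespace PrincipalBundle

variable {EG : Type*} [NormedAddCommGroup EG] [NormedSpace ℝ EG]
  {G : Type*} [Group G] [TopologicalSpace G] [ChartedSpace EG G]
  {EM : Type*} [NormedAddCommGroup EM] [NormedSpace ℝ EM]
  {M : Type*} [TopologicalSpace M] [ChartedSpace EM M]

/-- The tangent space of the total space. -/
abbrev T (P : PrincipalBundle.{u, v} EG G EM M) (p : P) : Type u := TangentSpace 𝓘(ℝ, P.E) p

/-- The vertical space at `p`. -/
def vertical (P : PrincipalBundle.{u, v} EG G EM M) (p : P) : Submodule ℝ (P.T p) :=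
  (mfderiv 𝓘(ℝ, P.E) 𝓘(ℝ, EM) P.π p).ker

/-- The differential at `p` of the action of `g`. -/
def dAct (P : PrincipalBundle.{u, v} EG G EM M) (g : G) (p : P) : P.T p →L[ℝ] P.T (g • p) :=
  mfderiv 𝓘(ℝ, P.E) 𝓘(ℝ, P.E) (fun q : P => g • q) p

/-- The value at `p` of the fundamental vector field `α†` of `α ∈ 𝔤 = T₁G`: the image of `α` under
the differential at `1` of `g ↦ g • p`. (The latter lies in the tangent space at `1 • p = p`.) -/
def fundamental (P : PrincipalBundle.{u, v} EG G EM M) (α : GroupLieAlgebra 𝓘(ℝ, EG) G) (p : P) :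
    P.T p :=
  (mfderiv 𝓘(ℝ, EG) 𝓘(ℝ, P.E) (fun g : G => g • p) 1 α : P.E)

/-- A morphism of principal `G`-bundles over `M`. -/
structure Hom (P Q : PrincipalBundle.{u, v} EG G EM M) where
  /-- The underlying map. -/
  map : P → Q
  smooth : ContMDiff 𝓘(ℝ, P.E) 𝓘(ℝ, Q.E) ∞ map
  equivariant : ∀ (g : G) (p : P), map (g • p) = g • map p
  over_base : ∀ p : P, Q.π (map p) = P.π p

/-- The differential of a morphism of principal bundles. -/
def Hom.d {P Q : PrincipalBundle.{u, v} EG G EM M} (Ψ : Hom P Q) (p : P) :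
    P.T p →L[ℝ] Q.T (Ψ.map p) :=
  mfderiv 𝓘(ℝ, P.E) 𝓘(ℝ, Q.E) Ψ.map p

end PrincipalBundle

section Cartan

variable {EG : Type*} [NormedAddCommGroup EG] [NormedSpace ℝ EG]
  {G : Type*} [Group G] [TopologicalSpace G] [ChartedSpace EG G] [LieGroup 𝓘(ℝ, EG) ∞ G]
  {V : Type*} [NormedAddCommGroup V] [NormedSpace ℝ V]
  {EM : Type*} [NormedAddCommGroup EM] [NormedSpace ℝ EM]
  {M : Type*} [TopologicalSpace M] [ChartedSpace EM M]

/-- The map `l = ω_e : 𝔤 → V` of a Pfaffian group; its kernel is the subspace `𝔥` in the notation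
`(G, 𝔥, V)`. -/
def PfaffianGroup.l (A : PfaffianGroup EG G V) : GroupLieAlgebra 𝓘(ℝ, EG) G →L[ℝ] V := A.form 1

/-- The form `θ` on `P` is `G`-equivariant. -/
def IsEquivariantForm (A : PfaffianGroup EG G V) (P : PrincipalBundle.{u, v} EG G EM M)
    (θ : ∀ p : P, P.T p →L[ℝ] V) : Prop :=
  ∀ (g : G) (p : P) (w : P.T p), θ (g • p) (P.dAct g p w) = A.ρ g (θ p w)

/-- A full principal Pfaffian `(G, 𝔥, V)`-bundle structure on the principal `G`-bundle `P`. -/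
@[ext] structure FullPfaffian (A : PfaffianGroup EG G V)
    (P : PrincipalBundle.{u, v} EG G EM M) where
  θ : ∀ p : P, P.T p →L[ℝ] V
  smooth : IsSmoothForm θ
  multiplicative : ∀ (g : G) (p : P) (v : TangentSpace 𝓘(ℝ, EG) g) (w : P.T p),
    θ (g • p) (mfderiv (𝓘(ℝ, EG).prod 𝓘(ℝ, P.E)) 𝓘(ℝ, P.E) (fun x : G × P => x.1 • x.2) (g, p)
      ((v, w) : EG × P.E)) = A.form g v + A.ρ g (θ p w)
  moment_projection : ∀ p : P, kerToPoint p ⊓ (θ p).ker = P.vertical p ⊓ (θ p).ker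
  full : ∀ p : P, Function.Surjective (θ p)

/-- A `G`-equivariant vertical foliation `F` on `P` with an isomorphism `Φ` of `G`-equivariant
vector bundles over `P` from the normal bundle `TP / F` to `P × V`, such that
`Φ [α†_p] = (p, l α)`. The isomorphism is given fibrewise. As the normal bundle is the quotient of
`TP` by `F`, a bundle map out of it is smooth when its composition with the projection of `TP` is
smooth. -/
@[ext] structure FoliationData (A : PfaffianGroup EG G V)
    (P : PrincipalBundle.{u, v} EG G EM M) where
  F : Foliation P.E P
  F_equivariant : ∀ (g : G) (p : P),
    (F.tangent p).map (P.dAct g p : P.T p →ₗ[ℝ] P.T (g • p)) = F.tangent (g • p)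
  F_vertical : ∀ p : P, F.tangent p ≤ P.vertical p
  Φ : ∀ p : P, (P.T p ⧸ F.tangent p) ≃ₗ[ℝ] V
  Φ_smooth : ContMDiff 𝓘(ℝ, P.E).tangent 𝓘(ℝ, V) ∞
    (fun w : TangentBundle 𝓘(ℝ, P.E) P => Φ w.proj ((F.tangent w.proj).mkQ w.snd))
  Φ_equivariant : ∀ (g : G) (p : P) (w : P.T p),
    Φ (g • p) ((F.tangent (g • p)).mkQ (P.dAct g p w)) = A.ρ g (Φ p ((F.tangent p).mkQ w))
  Φ_fundamental : ∀ (α : GroupLieAlgebra 𝓘(ℝ, EG) G) (p : P),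
    Φ p ((F.tangent p).mkQ (P.fundamental α p)) = A.l α

/-- A (smooth, pointwise surjective) equivariant `V`-valued one-form on `P` with involutive and
vertical kernel, such that `θ(α†_p) = l α`. -/
@[ext] structure FormData (A : PfaffianGroup EG G V)
    (P : PrincipalBundle.{u, v} EG G EM M) where
  θ : ∀ p : P, P.T p →L[ℝ] V
  smooth : IsSmoothForm θ
  surjective : ∀ p : P, Function.Surjective (θ p)
  equivariant : IsEquivariantForm A P θ
  ker_involutive : IsInvolutive fun p : P => (θ p).ker
  ker_vertical : ∀ p : P, (θ p).ker ≤ P.vertical p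
  fundamental : ∀ (α : GroupLieAlgebra 𝓘(ℝ, EG) G) (p : P), θ p (P.fundamental α p) = A.l α

variable {A : PfaffianGroup EG G V} {P Q : PrincipalBundle.{u, v} EG G EM M}

/-- `Ψ` is a morphism of principal Pfaffian bundles: `Ψ^* θ' = θ`. -/
def FullPfaffian.IsMorphism (S : FullPfaffian A P) (S' : FullPfaffian A Q)
    (Ψ : PrincipalBundle.Hom P Q) : Prop :=
  ∀ (p : P) (w : P.T p), S'.θ (Ψ.map p) (Ψ.d p w) = S.θ p w

/-- `Ψ` maps leaves into leaves, and the induced map of normal bundles is compatible with the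
isomorphisms to the trivial bundles. -/
def FoliationData.IsMorphism (S : FoliationData A P) (S' : FoliationData A Q)
    (Ψ : PrincipalBundle.Hom P Q) : Prop :=
  (∀ p : P, (S.F.tangent p).map (Ψ.d p : P.T p →ₗ[ℝ] Q.T (Ψ.map p)) ≤ S'.F.tangent (Ψ.map p)) ∧
  ∀ (p : P) (w : P.T p), S'.Φ (Ψ.map p) ((S'.F.tangent (Ψ.map p)).mkQ (Ψ.d p w)) =
    S.Φ p ((S.F.tangent p).mkQ w)

/-- `Ψ` preserves the forms. -/
def FormData.IsMorphism (S : FormData A P) (S' : FormData A Q)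
    (Ψ : PrincipalBundle.Hom P Q) : Prop :=
  ∀ (p : P) (w : P.T p), S'.θ (Ψ.map p) (Ψ.d p w) = S.θ p w

end Cartan

end Pfaffian

end

open Pfaffian

/-!
The pullback of a multiplicative `θ` along an orbit map `g ↦ g • p` is the form of the Pfaffian
group, which is constant on right-invariant vector fields. Hence multiplicativity of `θ` amounts to
its equivariance and the equation `θ(α†) = l(α)`, and what remains is the involutivity of `ker θ`.

As `ker θ` is vertical, it suffices to know that every vertical vector is a fundamental vector `α†`:
then `dθ` vanishes on `ker θ`, because it pulls back along orbit maps to the exterior derivative of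
the form of the Pfaffian group, and the latter vanishes on `ker l` by involutivity of the symbol
foliation. By Cartan's formula, `ker θ` is closed under brackets. The map `α ↦ α†` is injective
since a zero of a fundamental vector field is fixed by the integral curve through `1` of the
corresponding right-invariant field, and the action is free. It fills the vertical space for
dimension reasons: by properness, orbit maps are open onto the fibres, so in submersion charts they
cover a neighbourhood in the fibre, and smooth maps do not increase Hausdorff dimension.

A surjective form is the same as its kernel together with the induced isomorphism from the quotient;
the kernel is a smooth distribution because near a point a fixed right inverse of `θ` provides
projections onto the kernels.
-/

open scoped Topology
open Set Filter

noncomputable section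

namespace Pfaffian

universe u v

section Charts

variable {𝕜 : Type*} [NontriviallyNormedField 𝕜]
  {E : Type*} [NormedAddCommGroup E] [NormedSpace 𝕜 E]
  {H : Type*} [TopologicalSpace H] {I : ModelWithCorners 𝕜 E H}
  {X : Type*} [TopologicalSpace X]

lemma extend_target_mem_nhds [I.Boundaryless] {e : OpenPartialHomeomorph X H} {x : X}
    (hx : x ∈ e.source) :
    (e.extend I).target ∈ 𝓝 (e.extend I x) := by
  simpa [I.range_eq_univ] using e.extend_target_mem_nhdsWithin (I := I) hx

variable [ChartedSpace H X]

lemma tendsto_extChartAt_symm_nhds (x : X) :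
    Tendsto (extChartAt I x).symm (𝓝 (extChartAt I x x)) (𝓝 x) := by
  have h := continuousAt_extChartAt_symm (I := I) x
  rwa [ContinuousAt, extChartAt_to_inv] at h

variable [I.Boundaryless] [IsManifold I 1 X]

lemma mdifferentiableAt_extChartAt_symm {x : X} {z : E} (hz : z ∈ (extChartAt I x).target) :
    MDifferentiableAt 𝓘(𝕜, E) I (extChartAt I x).symm z :=
  ((contMDiffOn_extChartAt_symm (n := 1) x).contMDiffAt
    ((isOpen_extChartAt_target x).mem_nhds hz)).mdifferentiableAt one_ne_zero

lemma mfderiv_extChartAt_symm_self (x : X) :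
    mfderiv 𝓘(𝕜, E) I (extChartAt I x).symm (extChartAt I x x) = ContinuousLinearMap.id 𝕜 E := by
  have h := mfderivWithin_range_extChartAt_symm (I := I) (x := x)
  rwa [I.range_eq_univ, mfderivWithin_univ] at h

lemma isInvertible_mfderiv_extChartAt_symm {x : X} {z : E} (hz : z ∈ (extChartAt I x).target) :
    (mfderiv 𝓘(𝕜, E) I (extChartAt I x).symm z).IsInvertible := by
  have h := isInvertible_mfderivWithin_extChartAt_symm (I := I) hz
  rwa [I.range_eq_univ, mfderivWithin_univ] at h

end Charts

section OneFormsOnVectorSpaces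

variable {𝕜 : Type*} [NontriviallyNormedField 𝕜]
  {E : Type*} [NormedAddCommGroup E] [NormedSpace 𝕜 E]
  {F : Type*} [NormedAddCommGroup F] [NormedSpace 𝕜 F]
  {θ : E → E →L[𝕜] F} {x : E}

lemma differentiableAt_ofSubsingleton_comp (hθ : DifferentiableAt 𝕜 θ x) :
    DifferentiableAt 𝕜
      (fun z => ContinuousAlternatingMap.ofSubsingleton 𝕜 E F (0 : Fin 1) (θ z)) x :=
  (ContinuousAlternatingMap.ofSubsingletonLIE (𝕜 := 𝕜) (E := E) (F := F)
    (0 : Fin 1)).differentiable.differentiableAt.comp x hθ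

lemma extDeriv_oneForm_apply {Y Z : E → E} (hθ : DifferentiableAt 𝕜 θ x)
    (hY : DifferentiableAt 𝕜 Y x) (hZ : DifferentiableAt 𝕜 Z x) :
    extDeriv (fun z => ContinuousAlternatingMap.ofSubsingleton 𝕜 E F (0 : Fin 1) (θ z)) x
        ![Y x, Z x] =
      fderiv 𝕜 (fun z => θ z (Z z)) x (Y x) - fderiv 𝕜 (fun z => θ z (Y z)) x (Z x)
        - θ x (VectorField.lieBracket 𝕜 Y Z x) := by
  have h := extDeriv_apply_vectorField (V := ![Y, Z]) (differentiableAt_ofSubsingleton_comp hθ)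
    (by simp [Fin.forall_fin_two, hY, hZ])
  have hYZ : (fun i => (![Y, Z] : Fin 2 → E → E) i x) = ![Y x, Z x] := by
    ext i
    fin_cases i <;> rfl
  rw [hYZ] at h
  simpa [Fin.sum_univ_two, Fin.removeNth, ← sub_eq_add_neg] using h

end OneFormsOnVectorSpaces

section OneForms

variable {E : Type*} [NormedAddCommGroup E] [NormedSpace ℝ E]
  {X : Type*} [TopologicalSpace X] [ChartedSpace E X]
  {E' : Type*} [NormedAddCommGroup E'] [NormedSpace ℝ E']
  {X' : Type*} [TopologicalSpace X'] [ChartedSpace E' X']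
  {V : Type*} [NormedAddCommGroup V] [NormedSpace ℝ V]

/-- The one-form `θ` read in the preferred chart at `x`. -/
def formInChart (θ : ∀ x : X, TangentSpace 𝓘(ℝ, E) x →L[ℝ] V) (x : X) (z : E) : E →L[ℝ] V :=
  (θ ((extChartAt 𝓘(ℝ, E) x).symm z)).comp
    (mfderiv 𝓘(ℝ, E) 𝓘(ℝ, E) (extChartAt 𝓘(ℝ, E) x).symm z)

/-- The exterior derivative of the one-form `θ` at `x`, computed in the preferred chart at `x`. -/
def extDerivForm (θ : ∀ x : X, TangentSpace 𝓘(ℝ, E) x →L[ℝ] V) (x : X) :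
    E [⋀^Fin 2]→L[ℝ] V :=
  extDeriv (fun z => ContinuousAlternatingMap.ofSubsingleton ℝ E V (0 : Fin 1)
    (formInChart θ x z)) (extChartAt 𝓘(ℝ, E) x x)

/-- The vector field `Y` read in the preferred chart at `x`. -/
def fieldInChart (Y : ∀ x : X, TangentSpace 𝓘(ℝ, E) x) (x : X) : E → E :=
  VectorField.mpullback 𝓘(ℝ, E) 𝓘(ℝ, E) (extChartAt 𝓘(ℝ, E) x).symm Y

lemma mpullbackWithin_range_extChartAt_symm (Y : ∀ x : X, TangentSpace 𝓘(ℝ, E) x) (x : X) :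
    VectorField.mpullbackWithin 𝓘(ℝ, E) 𝓘(ℝ, E) (extChartAt 𝓘(ℝ, E) x).symm Y
      (range 𝓘(ℝ, E)) = fieldInChart Y x := by
  rw [ModelWithCorners.range_eq_univ, VectorField.mpullbackWithin_univ, fieldInChart]

variable [IsManifold 𝓘(ℝ, E) ∞ X] [IsManifold 𝓘(ℝ, E') ∞ X']
  {θ : ∀ x : X, TangentSpace 𝓘(ℝ, E) x →L[ℝ] V} {Y Z : ∀ x : X, TangentSpace 𝓘(ℝ, E) x}
  {U : Set X} {x : X}

lemma formInChart_self : formInChart θ x (extChartAt 𝓘(ℝ, E) x x) = θ x := by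
  ext a
  exact (congrArg (fun y : X => (θ y : E → V)
      (mfderiv 𝓘(ℝ, E) 𝓘(ℝ, E) (extChartAt 𝓘(ℝ, E) x).symm (extChartAt 𝓘(ℝ, E) x x) a))
    (extChartAt_to_inv (I := 𝓘(ℝ, E)) x)).trans
    (congrArg (θ x) (DFunLike.congr_fun (mfderiv_extChartAt_symm_self x) a))

lemma contDiffOn_formInChart [FiniteDimensional ℝ E] (hθ : IsSmoothForm θ) (x : X) :
    ContDiffOn ℝ ∞ (formInChart θ x) (extChartAt 𝓘(ℝ, E) x).target := by
  rw [contDiffOn_clm_apply]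
  intro e
  rw [← contMDiffOn_iff_contDiffOn]
  have hunique := (isOpen_extChartAt_target (I := 𝓘(ℝ, E)) x).uniqueMDiffOn (I := 𝓘(ℝ, E))
  have htangent := (contMDiffOn_extChartAt_symm (I := 𝓘(ℝ, E)) (n := ∞)
    x).contMDiffOn_tangentMapWithin (m := ∞) (by simp) hunique
  have hconst : ContMDiff 𝓘(ℝ, E) 𝓘(ℝ, E).tangent ∞
      (fun z : E => (⟨z, e⟩ : TangentBundle 𝓘(ℝ, E) E)) :=
    contMDiff_vectorSpace_iff_contDiff.2 contDiff_const
  refine (hθ.comp_contMDiffOn (htangent.comp (hconst.contMDiffOn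
    (s := (extChartAt 𝓘(ℝ, E) x).target)) fun z hz => hz)).congr fun z hz => ?_
  simp only [Function.comp_apply, tangentMapWithin]
  rw [mfderivWithin_eq_mfderiv (hunique z hz) (mdifferentiableAt_extChartAt_symm hz)]
  rfl

lemma differentiableAt_formInChart [FiniteDimensional ℝ E] (hθ : IsSmoothForm θ) (x : X) :
    DifferentiableAt ℝ (formInChart θ x) (extChartAt 𝓘(ℝ, E) x x) :=
  ((contDiffOn_formInChart hθ x).contDiffAt (extChartAt_target_mem_nhds x)).differentiableAt
    (by simp)

lemma formInChart_fieldInChart {z : E} (hz : z ∈ (extChartAt 𝓘(ℝ, E) x).target) :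
    formInChart θ x z (fieldInChart Y x z) =
      θ ((extChartAt 𝓘(ℝ, E) x).symm z) (Y ((extChartAt 𝓘(ℝ, E) x).symm z)) :=
  congrArg (θ _) ((isInvertible_mfderiv_extChartAt_symm hz).self_apply_inverse _)

lemma fieldInChart_self : fieldInChart Y x (extChartAt 𝓘(ℝ, E) x x) = Y x := by
  rw [fieldInChart, VectorField.mpullback_apply, mfderiv_extChartAt_symm_self]
  exact (DFunLike.congr_fun (ContinuousLinearMap.inverse_id (R := ℝ) (M := E)) _).trans
    (congrArg (fun y : X => (Y y : E)) (extChartAt_to_inv (I := 𝓘(ℝ, E)) x))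

lemma mlieBracket_eq_lieBracket_fieldInChart :
    VectorField.mlieBracket 𝓘(ℝ, E) Y Z x =
      VectorField.lieBracket ℝ (fieldInChart Y x) (fieldInChart Z x)
        (extChartAt 𝓘(ℝ, E) x x) := by
  rw [← VectorField.mlieBracketWithin_univ, VectorField.mlieBracketWithin_apply,
    mpullbackWithin_range_extChartAt_symm, mpullbackWithin_range_extChartAt_symm,
    mfderiv_extChartAt_self, preimage_univ, univ_inter, modelWithCornersSelf_coe, range_id,
    VectorField.lieBracketWithin_univ]
  exact DFunLike.congr_fun (ContinuousLinearMap.inverse_id (R := ℝ) (M := E)) _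

lemma differentiableAt_fieldInChart [CompleteSpace E] (hU : U ∈ 𝓝 x)
    (hY : IsSmoothFieldOn Y U) :
    DifferentiableAt ℝ (fieldInChart Y x) (extChartAt 𝓘(ℝ, E) x x) := by
  have h := VectorField.contMDiffWithinAt_mpullbackWithin_extChartAt_symm (n := ∞) (m := ∞)
    (hY.contMDiffAt hU).contMDiffWithinAt uniqueMDiffOn_univ (mem_univ x) (by simp)
  rw [contMDiffWithinAt_vectorSpace_iff_contDiffWithinAt, preimage_univ, inter_univ,
    mpullbackWithin_range_extChartAt_symm] at h
  exact (h.contDiffAt (extChartAt_target_mem_nhds x)).differentiableAt (by simp)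

lemma apply_mlieBracket_eq_neg_extDerivForm [FiniteDimensional ℝ E] (hθ : IsSmoothForm θ)
    (hU : U ∈ 𝓝 x) (hY : IsSmoothFieldOn Y U) (hZ : IsSmoothFieldOn Z U)
    (hθY : ∀ y ∈ U, Y y ∈ (θ y).ker) (hθZ : ∀ y ∈ U, Z y ∈ (θ y).ker) :
    θ x (VectorField.mlieBracket 𝓘(ℝ, E) Y Z x) = -extDerivForm θ x ![Y x, Z x] := by
  have : CompleteSpace E := FiniteDimensional.complete ℝ E
  have hvanish {W : ∀ x : X, TangentSpace 𝓘(ℝ, E) x} (hθW : ∀ y ∈ U, W y ∈ (θ y).ker) :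
      (fun z => formInChart θ x z (fieldInChart W x z)) =ᶠ[𝓝 (extChartAt 𝓘(ℝ, E) x x)]
        fun _ => 0 := by
    filter_upwards [tendsto_extChartAt_symm_nhds (I := 𝓘(ℝ, E)) x hU,
      extChartAt_target_mem_nhds (I := 𝓘(ℝ, E)) x] with z hz hz'
    exact (formInChart_fieldInChart hz').trans (hθW _ hz)
  have hcartan := extDeriv_oneForm_apply (differentiableAt_formInChart hθ x)
    (differentiableAt_fieldInChart hU hY) (differentiableAt_fieldInChart hU hZ)
  simp only [(hvanish hθY).fderiv_eq, (hvanish hθZ).fderiv_eq, fderiv_fun_const, Pi.zero_apply,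
    zero_apply, sub_zero, zero_sub] at hcartan
  rw [← mlieBracket_eq_lieBracket_fieldInChart, formInChart_self, fieldInChart_self,
    fieldInChart_self] at hcartan
  exact neg_eq_iff_eq_neg.1 hcartan.symm

lemma isInvolutive_ker [FiniteDimensional ℝ E] (hθ : IsSmoothForm θ)
    (hdθ : ∀ x, ∀ v ∈ (θ x).ker, ∀ w ∈ (θ x).ker, extDerivForm θ x ![v, w] = 0) :
    IsInvolutive fun x => (θ x).ker := by
  intro U hU Y Z hY hZ hθY hθZ x hx
  refine (apply_mlieBracket_eq_neg_extDerivForm hθ (hU.mem_nhds hx) hY hZ hθY hθZ).trans ?_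
  rw [hdθ x _ (hθY x hx) _ (hθZ x hx), neg_zero]

variable {f : X' → X} {x : X'}

lemma eventually_formInChart_pullback (hf : ContMDiff 𝓘(ℝ, E') 𝓘(ℝ, E) ∞ f)
    {θ' : ∀ x : X', TangentSpace 𝓘(ℝ, E') x →L[ℝ] V}
    (hθ' : ∀ x, θ' x = (θ (f x)).comp (mfderiv 𝓘(ℝ, E') 𝓘(ℝ, E) f x)) :
    ∀ᶠ z in 𝓝 (extChartAt 𝓘(ℝ, E') x x),
      formInChart θ' x z =
        (formInChart θ (f x) (writtenInExtChartAt 𝓘(ℝ, E') 𝓘(ℝ, E) x f z)).comp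
          (fderiv ℝ (writtenInExtChartAt 𝓘(ℝ, E') 𝓘(ℝ, E) x f) z) := by
  set φ := extChartAt 𝓘(ℝ, E') x
  set ψ := extChartAt 𝓘(ℝ, E) (f x)
  set F := writtenInExtChartAt 𝓘(ℝ, E') 𝓘(ℝ, E) x f
  have hsource : ∀ᶠ z in 𝓝 (φ x), f (φ.symm z) ∈ ψ.source :=
    (tendsto_extChartAt_symm_nhds x).eventually
      (hf.continuous.continuousAt.eventually (extChartAt_source_mem_nhds (f x)))
  filter_upwards [hsource, hsource.eventually_nhds, extChartAt_target_mem_nhds (I := 𝓘(ℝ, E')) x]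
    with z hz hz_nhds hz_target
  have hφ := mdifferentiableAt_extChartAt_symm hz_target
  have hfz := (hf (φ.symm z)).mdifferentiableAt (by simp)
  have hF : MDifferentiableAt 𝓘(ℝ, E') 𝓘(ℝ, E) F z := by
    have hz_chart : f (φ.symm z) ∈ (chartAt E (f x)).source := by rwa [← extChartAt_source 𝓘(ℝ, E)]
    exact ((contMDiffAt_extChartAt' (n := ∞) hz_chart).mdifferentiableAt (by simp)).comp z
      (hfz.comp z hφ)
  have hψ := mdifferentiableAt_extChartAt_symm (I := 𝓘(ℝ, E)) (ψ.map_source hz)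
  have hfactor : ψ.symm ∘ F =ᶠ[𝓝 z] f ∘ φ.symm := by
    filter_upwards [hz_nhds] with y hy
    exact ψ.left_inv hy
  have hderiv := hfactor.mfderiv_eq (I := 𝓘(ℝ, E')) (I' := 𝓘(ℝ, E))
  rw [mfderiv_comp z hψ hF, mfderiv_comp z hfz hφ, mfderiv_eq_fderiv] at hderiv
  ext v
  refine (DFunLike.congr_fun (hθ' (φ.symm z)) _).trans ?_
  exact (congrArg (θ (f (φ.symm z))) (DFunLike.congr_fun hderiv v).symm).trans
    (congrArg (fun y : X => (θ y : E → V) (mfderiv 𝓘(ℝ, E) 𝓘(ℝ, E) ψ.symm (F z) (fderiv ℝ F z v)))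
      (ψ.left_inv hz).symm)

lemma extDerivForm_pullback [FiniteDimensional ℝ E] (hθ : IsSmoothForm θ)
    (hf : ContMDiff 𝓘(ℝ, E') 𝓘(ℝ, E) ∞ f) {θ' : ∀ x : X', TangentSpace 𝓘(ℝ, E') x →L[ℝ] V}
    (hθ' : ∀ x, θ' x = (θ (f x)).comp (mfderiv 𝓘(ℝ, E') 𝓘(ℝ, E) f x)) :
    extDerivForm θ' x =
      (extDerivForm θ (f x)).compContinuousLinearMap (mfderiv 𝓘(ℝ, E') 𝓘(ℝ, E) f x) := by
  set F := writtenInExtChartAt 𝓘(ℝ, E') 𝓘(ℝ, E) x f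
  set z := extChartAt 𝓘(ℝ, E') x x
  have hFz : F z = extChartAt 𝓘(ℝ, E) (f x) (f x) := by simp [F, z, writtenInExtChartAt]
  have hF : ContDiffAt ℝ ∞ F z := by
    have h := (contMDiffAt_iff.1 (hf x)).2
    rwa [ModelWithCorners.range_eq_univ, contDiffWithinAt_univ] at h
  have hFderiv : mfderiv 𝓘(ℝ, E') 𝓘(ℝ, E) f x = fderiv ℝ F z := by
    rw [((hf x).mdifferentiableAt (by simp)).mfderiv, ModelWithCorners.range_eq_univ,
      fderivWithin_univ]
  have hθF : DifferentiableAt ℝ (formInChart θ (f x)) (F z) :=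
    hFz ▸ differentiableAt_formInChart hθ (f x)
  have hpullback : (fun w => ContinuousAlternatingMap.ofSubsingleton ℝ E' V (0 : Fin 1)
      (formInChart θ' x w)) =ᶠ[𝓝 z] fun w =>
      (ContinuousAlternatingMap.ofSubsingleton ℝ E V (0 : Fin 1)
        (formInChart θ (f x) (F w))).compContinuousLinearMap (fderiv ℝ F w) := by
    filter_upwards [eventually_formInChart_pullback hf hθ'] with w hw
    rw [hw]
    rfl
  have hmin : minSmoothness ℝ 2 ≤ ∞ := by
    rw [minSmoothness_of_isRCLikeNormedField]
    exact ENat.LEInfty.out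
  rw [extDerivForm, hpullback.extDeriv_eq,
    extDeriv_pullback (differentiableAt_ofSubsingleton_comp hθF) hF hmin, hFz, hFderiv]
  rfl

end OneForms

section KernelFrames

variable {𝕜 : Type*} [NontriviallyNormedField 𝕜]
  {E : Type*} [NormedAddCommGroup E] [NormedSpace 𝕜 E]
  {V : Type*} [NormedAddCommGroup V] [NormedSpace 𝕜 V]

/-- The projection of `v` to the kernel of `L` along the range of `s`, when `L ∘ s` is
invertible. -/
def kerProj (s : V →L[𝕜] E) (L : E →L[𝕜] V) (v : E) : E :=
  v - s ((L.comp s).inverse (L v))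

lemma apply_kerProj {s : V →L[𝕜] E} {L : E →L[𝕜] V} (hL : (L.comp s).IsInvertible) (v : E) :
    L (kerProj s L v) = 0 := by
  rw [kerProj, map_sub]
  exact sub_eq_zero.2 (hL.self_apply_inverse (L v)).symm

lemma kerProj_of_apply_eq_zero (s : V →L[𝕜] E) {L : E →L[𝕜] V} {v : E} (hv : L v = 0) :
    kerProj s L v = v := by
  rw [kerProj, hv, map_zero, map_zero, sub_zero]

lemma contDiffAt_kerProj [CompleteSpace V] {n : WithTop ℕ∞} {s : V →L[𝕜] E} {L : E →L[𝕜] V}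
    (hL : (L.comp s).IsInvertible) (v : E) : ContDiffAt 𝕜 n (fun L => kerProj s L v) L := by
  obtain ⟨e, he⟩ := hL
  have hinverse : ContDiffAt 𝕜 n ContinuousLinearMap.inverse (L.comp s) :=
    he ▸ contDiffAt_map_inverse e
  exact contDiffAt_const.sub (s.contDiff.contDiffAt.comp L
    ((hinverse.comp L (contDiffAt_id.clm_comp contDiffAt_const)).clm_apply
      (contDiffAt_id.clm_apply contDiffAt_const)))

variable [FiniteDimensional 𝕜 E]

lemma finrank_ker_of_surjective {L : E →L[𝕜] V} (hL : Function.Surjective L) :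
    Module.finrank 𝕜 L.ker = Module.finrank 𝕜 E - Module.finrank 𝕜 V := by
  have h := (L : E →ₗ[𝕜] V).finrank_range_add_finrank_ker
  rw [LinearMap.range_eq_top.2 hL, finrank_top] at h
  exact Nat.eq_sub_of_add_eq' h

variable [CompleteSpace 𝕜] [FiniteDimensional 𝕜 V]

lemma exists_contDiffOn_frame_ker {n : WithTop ℕ∞} {L : E → E →L[𝕜] V} {T : Set E} (hT : IsOpen T)
    (hL : ContDiffOn 𝕜 n L T) {z₀ : E} (hz₀ : z₀ ∈ T) (hsurj : Function.Surjective (L z₀)) :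
    ∃ W ⊆ T, IsOpen W ∧ z₀ ∈ W ∧
      ∃ u : Fin (Module.finrank 𝕜 E - Module.finrank 𝕜 V) → E → E,
        (∀ i, ContDiffOn 𝕜 n (u i) W) ∧
        ∀ z ∈ W, LinearIndependent 𝕜 (fun i => u i z) ∧ ∀ i, L z (u i z) = 0 := by
  have : CompleteSpace V := FiniteDimensional.complete 𝕜 V
  obtain ⟨s, hs⟩ := ContinuousLinearMap.HasRightInverse.of_surjective_of_finiteDimensional hsurj
  let b := Module.finBasisOfFinrankEq 𝕜 (L z₀).ker (finrank_ker_of_surjective hsurj)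
  have hb : LinearIndependent 𝕜 fun i => (b i : E) :=
    b.linearIndependent.map' (L z₀).ker.subtype (L z₀).ker.ker_subtype
  let W := T ∩ (fun z => (L z).comp s) ⁻¹' {A | A.IsInvertible}
  have hW : IsOpen W := (hL.continuousOn.clm_comp continuousOn_const).isOpen_inter_preimage hT
    ContinuousLinearEquiv.isOpen
  let u := fun i z => kerProj s (L z) (b i)
  have hu i : ContDiffOn 𝕜 n (u i) W := fun z hz =>
    (contDiffAt_kerProj hz.2 (b i : E)).comp_contDiffWithinAt z
      ((hL z hz.1).mono inter_subset_left)
  have hu₀ i : u i z₀ = b i := kerProj_of_apply_eq_zero s (b i).2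
  refine ⟨W ∩ (fun z i => u i z) ⁻¹' {v | LinearIndependent 𝕜 v},
    inter_subset_left.trans inter_subset_left,
    (continuousOn_pi.2 fun i => (hu i).continuousOn).isOpen_inter_preimage hW
      isOpen_setOfPred_linearIndependent, ⟨⟨hz₀, .refl 𝕜 V, ?_⟩, ?_⟩, u,
    fun i => (hu i).mono inter_subset_left,
    fun z hz => ⟨hz.2, fun i => apply_kerProj hz.1.2 (b i : E)⟩⟩
  · exact ContinuousLinearMap.ext fun v => (hs v).symm
  · simpa only [mem_preimage, hu₀, mem_ofPred_eq] using hb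

end KernelFrames

section KernelDistribution

variable {E : Type*} [NormedAddCommGroup E] [NormedSpace ℝ E]
  {X : Type*} [TopologicalSpace X] [ChartedSpace E X]

/-- The vector field on the domain of the preferred chart at `x` given in the chart by `u`. -/
def fieldOfChart (x : X) (u : E → E) (y : X) : TangentSpace 𝓘(ℝ, E) y :=
  (mfderiv 𝓘(ℝ, E) 𝓘(ℝ, E) (extChartAt 𝓘(ℝ, E) x).symm (extChartAt 𝓘(ℝ, E) x y)
    (u (extChartAt 𝓘(ℝ, E) x y)) : E)

variable {V : Type*} [NormedAddCommGroup V] [NormedSpace ℝ V]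
  {θ : ∀ x : X, TangentSpace 𝓘(ℝ, E) x →L[ℝ] V} {x y : X}

lemma apply_fieldOfChart (hy : y ∈ (extChartAt 𝓘(ℝ, E) x).source) (u : E → E) :
    θ y (fieldOfChart x u y) =
      formInChart θ x (extChartAt 𝓘(ℝ, E) x y) (u (extChartAt 𝓘(ℝ, E) x y)) :=
  congrArg (fun q : X => (θ q : E → V) (fieldOfChart x u y))
    ((extChartAt 𝓘(ℝ, E) x).left_inv hy).symm

variable [IsManifold 𝓘(ℝ, E) ∞ X]

lemma isSmoothFieldOn_fieldOfChart {u : E → E} {W : Set E}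
    (hW : W ⊆ (extChartAt 𝓘(ℝ, E) x).target) (hu : ContDiffOn ℝ ∞ u W) :
    IsSmoothFieldOn (fieldOfChart x u)
      ((extChartAt 𝓘(ℝ, E) x).source ∩ extChartAt 𝓘(ℝ, E) x ⁻¹' W) := by
  set φ := extChartAt 𝓘(ℝ, E) x
  have hunique := (isOpen_extChartAt_target (I := 𝓘(ℝ, E)) x).uniqueMDiffOn (I := 𝓘(ℝ, E))
  have htangent := (contMDiffOn_extChartAt_symm (I := 𝓘(ℝ, E)) (n := ∞)
    x).contMDiffOn_tangentMapWithin (m := ∞) (by simp) hunique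
  have hu' : ContMDiffOn 𝓘(ℝ, E) 𝓘(ℝ, E).tangent ∞
      (fun z : E => (⟨z, u z⟩ : TangentBundle 𝓘(ℝ, E) E)) W :=
    contMDiffOn_vectorSpace_iff_contDiffOn.2 hu
  have hφ : ContMDiffOn 𝓘(ℝ, E) 𝓘(ℝ, E) ∞ φ (φ.source ∩ φ ⁻¹' W) :=
    (contMDiffOn_extChartAt (I := 𝓘(ℝ, E)) (n := ∞)).mono fun y hy => by
      rw [← extChartAt_source 𝓘(ℝ, E)]
      exact hy.1
  refine ((htangent.comp hu' fun z hz => hW hz).comp hφ fun y hy => hy.2).congr fun y hy => ?_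
  simp only [Function.comp_apply, tangentMapWithin]
  rw [mfderivWithin_eq_mfderiv (hunique _ (hW hy.2)) (mdifferentiableAt_extChartAt_symm (hW hy.2))]
  exact congrArg (fun q : X => (⟨q, fieldOfChart x u y⟩ : TangentBundle 𝓘(ℝ, E) X))
    (φ.left_inv hy.1).symm

lemma linearIndependent_fieldOfChart {ι : Type*} {u : ι → E → E}
    (hy : extChartAt 𝓘(ℝ, E) x y ∈ (extChartAt 𝓘(ℝ, E) x).target)
    (hu : LinearIndependent ℝ fun i => u i (extChartAt 𝓘(ℝ, E) x y)) :
    LinearIndependent ℝ fun i => fieldOfChart x (u i) y :=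
  hu.map' _ (LinearMap.ker_eq_bot.2 (isInvertible_mfderiv_extChartAt_symm hy).injective)

lemma isRegularDistribution_ker [FiniteDimensional ℝ E] [FiniteDimensional ℝ V]
    (hθ : IsSmoothForm θ) (hsurj : ∀ x, Function.Surjective (θ x)) :
    IsRegularDistribution fun x => (θ x).ker := by
  refine ⟨Module.finrank ℝ E - Module.finrank ℝ V, fun x => ?_⟩
  obtain ⟨W, hWT, hW, hxW, u, hu, hframe⟩ := exists_contDiffOn_frame_ker
    (isOpen_extChartAt_target x) (contDiffOn_formInChart hθ x) (mem_extChartAt_target x)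
    (by rw [formInChart_self]; exact hsurj x)
  refine ⟨(extChartAt 𝓘(ℝ, E) x).source ∩ extChartAt 𝓘(ℝ, E) x ⁻¹' W,
    (continuousOn_extChartAt x).isOpen_inter_preimage (isOpen_extChartAt_source x) hW,
    ⟨mem_extChartAt_source x, hxW⟩, fun i => fieldOfChart x (u i),
    fun i => isSmoothFieldOn_fieldOfChart hWT (hu i), fun y hy => ?_⟩
  obtain ⟨hli, hker⟩ := hframe _ hy.2
  have hli' := linearIndependent_fieldOfChart (hWT hy.2) hli
  have : FiniteDimensional ℝ (TangentSpace 𝓘(ℝ, E) y) := inferInstanceAs (FiniteDimensional ℝ E)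
  refine ⟨hli', Submodule.eq_of_le_of_finrank_eq (Submodule.span_le.2 ?_) ?_⟩
  · rintro _ ⟨i, rfl⟩
    exact (apply_fieldOfChart hy.1 (u i)).trans (hker i)
  · rw [finrank_span_eq_card hli', Fintype.card_fin]
    exact (finrank_ker_of_surjective (E := E) (hsurj y)).symm

end KernelDistribution

section DimensionBound

variable {E : Type*} [NormedAddCommGroup E] [NormedSpace ℝ E] [FiniteDimensional ℝ E]
  {H : Type*} [TopologicalSpace H] {I : ModelWithCorners ℝ E H} [I.Boundaryless]
  {X : Type*} [TopologicalSpace X] [ChartedSpace H X]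
  {F : Type*} [NormedAddCommGroup F] [NormedSpace ℝ F] [FiniteDimensional ℝ F]

lemma finrank_le_of_nhds_le_map {f : X → F} {x : X} (hf : ContMDiffAt I 𝓘(ℝ, F) 1 f x)
    (h : 𝓝 (f x) ≤ map f (𝓝 x)) : Module.finrank ℝ F ≤ Module.finrank ℝ E := by
  set f' : E → F := f ∘ (extChartAt I x).symm
  have hf' : ContDiffAt ℝ 1 f' (extChartAt I x x) := by
    simpa only [extChartAt_model_space_eq_id, PartialEquiv.refl_coe, Function.id_comp,
      I.range_eq_univ, contDiffWithinAt_univ] using (contMDiffAt_iff.1 hf).2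
  obtain ⟨B, hB, hfB⟩ := hf'.contDiffOn le_rfl (by simp)
  obtain ⟨r, hr, hrB⟩ := Metric.mem_nhds_iff.1 hB
  have himage : f' '' Metric.ball (extChartAt I x x) r ∈ 𝓝 (f x) := by
    refine h ?_
    rw [← map_extChartAt_symm_nhdsWithin_range (I := I) x, I.range_eq_univ, nhdsWithin_univ,
      map_map]
    exact image_mem_map (Metric.ball_mem_nhds _ hr)
  suffices (Module.finrank ℝ F : ENNReal) ≤ Module.finrank ℝ E by exact_mod_cast this
  calc (Module.finrank ℝ F : ENNReal)
      = dimH (f' '' Metric.ball (extChartAt I x x) r) := (Real.dimH_of_mem_nhds himage).symm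
    _ ≤ dimH (Metric.ball (extChartAt I x x) r) :=
      (hfB.mono hrB).dimH_image_le (convex_ball _ _) subset_rfl
    _ ≤ dimH (univ : Set E) := dimH_mono (subset_univ _)
    _ = Module.finrank ℝ E := Real.dimH_univ_eq_finrank E

end DimensionBound

section Submersion

open Manifold (IsSubmersionAtOfComplement IsSubmersionAt)

variable {𝕜 : Type*} [NontriviallyNormedField 𝕜]
  {E : Type*} [NormedAddCommGroup E] [NormedSpace 𝕜 E]
  {E' : Type*} [NormedAddCommGroup E'] [NormedSpace 𝕜 E']
  {F : Type*} [NormedAddCommGroup F] [NormedSpace 𝕜 F]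
  {H : Type*} [TopologicalSpace H] {I : ModelWithCorners 𝕜 E H}
  {H' : Type*} [TopologicalSpace H'] {J : ModelWithCorners 𝕜 E' H'}
  {X : Type*} [TopologicalSpace X] [ChartedSpace H X]
  {X' : Type*} [TopologicalSpace X'] [ChartedSpace H' X']
  {n : WithTop ℕ∞} {f : X → X'} {x : X}

lemma mfderiv_continuousLinearMap_comp_apply {g : X → E} (hg : MDifferentiableAt I 𝓘(𝕜, E) g x)
    (L : E →L[𝕜] F) (v : TangentSpace I x) :
    mfderiv I 𝓘(𝕜, F) (L ∘ g) x v = L (mfderiv I 𝓘(𝕜, E) g x v) := by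
  rw [mfderiv_comp_apply x L.mdifferentiableAt hg, L.mfderiv_eq]
  rfl

/-- The coordinates along the fibres of a submersion `f` in submersion charts around `x`. -/
def fibreCoord (h : IsSubmersionAtOfComplement F I J n f x) (y : X) : F :=
  (h.equiv (h.domChart.extend I y)).2

lemma contMDiffAt_fibreCoord (h : IsSubmersionAtOfComplement F I J n f x) :
    ContMDiffAt I 𝓘(𝕜, F) n (fibreCoord h) x :=
  (contDiff_snd.comp h.equiv.contDiff).contMDiff.contMDiffAt.comp x
    (h.domChart.contMDiffAt_extend h.domChart_mem_maximalAtlas h.mem_domChart_source)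

lemma equiv_extend_eq (h : IsSubmersionAtOfComplement F I J n f x) {y : X}
    (hy : y ∈ h.domChart.source) :
    h.equiv (h.domChart.extend I y) = (h.codChart.extend J (f y), fibreCoord h y) := by
  have hy' : y ∈ (h.domChart.extend I).source := by rwa [OpenPartialHomeomorph.extend_source]
  refine Prod.ext ?_ rfl
  have hf := h.writtenInCharts ((h.domChart.extend I).map_source hy')
  simp only [Function.comp_apply, (h.domChart.extend I).left_inv hy'] at hf
  exact hf.symm

variable [I.Boundaryless]

lemma nhds_fibreCoord_le_map (h : IsSubmersionAtOfComplement F I J n f x) :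
    𝓝 (fibreCoord h x) ≤ map (fibreCoord h) (𝓝[f ⁻¹' {f x}] x) := by
  set φ := h.domChart.extend I
  set s : F → X := fun v => φ.symm (h.equiv.symm (h.codChart.extend J (f x), v))
  have hφx : h.equiv.symm (h.codChart.extend J (f x), fibreCoord h x) = φ x :=
    h.equiv.symm_apply_eq.2 (equiv_extend_eq h h.mem_domChart_source).symm
  have hline : Tendsto (fun v : F => h.equiv.symm (h.codChart.extend J (f x), v))
      (𝓝 (fibreCoord h x)) (𝓝 (φ x)) := by
    rw [← hφx]
    exact (h.equiv.symm.continuous.comp (Continuous.prodMk_right _)).continuousAt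
  have htarget : ∀ᶠ v in 𝓝 (fibreCoord h x),
      h.equiv.symm (h.codChart.extend J (f x), v) ∈ φ.target :=
    hline.eventually (extend_target_mem_nhds h.mem_domChart_source)
  have hcoord : ∀ᶠ v in 𝓝 (fibreCoord h x), f (s v) = f x ∧ fibreCoord h (s v) = v := by
    filter_upwards [htarget] with v hv
    have hsv : s v ∈ h.domChart.source := by
      simpa only [φ, OpenPartialHomeomorph.extend_source] using φ.map_target hv
    have heq := equiv_extend_eq h hsv
    rw [show h.domChart.extend I (s v) = _ from φ.right_inv hv, h.equiv.apply_symm_apply,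
      Prod.mk.injEq] at heq
    refine ⟨(h.codChart.extend J).injOn ?_ ?_ heq.1.symm, heq.2.symm⟩
    · rw [OpenPartialHomeomorph.extend_source]
      exact h.source_subset_preimage_source hsv
    · simpa only [OpenPartialHomeomorph.extend_source] using h.mem_codChart_source
  have hs : Tendsto s (𝓝 (fibreCoord h x)) (𝓝[f ⁻¹' {f x}] x) := by
    refine tendsto_nhdsWithin_iff.2 ⟨?_, hcoord.mono fun v hv => hv.1⟩
    have hsymm := h.domChart.continuousAt_extend_symm (I := I) h.mem_domChart_source
    rw [ContinuousAt, h.domChart.extend_left_inv h.mem_domChart_source] at hsymm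
    exact hsymm.comp hline
  intro A hA
  filter_upwards [hs hA, hcoord] with v hv hv'
  exact hv'.2 ▸ hv

lemma mfderiv_extend_injective (hn : n ≠ 0) {e : OpenPartialHomeomorph X H}
    (he : e ∈ IsManifold.maximalAtlas I n X) (hx : x ∈ e.source) :
    Function.Injective (mfderiv I 𝓘(𝕜, E) (e.extend I) x) := by
  have hsymm : MDifferentiableAt 𝓘(𝕜, E) I (e.extend I).symm (e.extend I x) := by
    refine ((contMDiffOn_extend_symm he).contMDiffAt ?_).mdifferentiableAt hn
    rw [← OpenPartialHomeomorph.extend_target']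
    exact extend_target_mem_nhds hx
  have hinv : (e.extend I).symm ∘ e.extend I =ᶠ[𝓝 x] id := by
    filter_upwards [e.extend_source_mem_nhds (I := I) hx] with y hy
    exact (e.extend I).left_inv hy
  refine Function.LeftInverse.injective
    (g := mfderiv 𝓘(𝕜, E) I (e.extend I).symm (e.extend I x)) fun v => ?_
  have hcomp := mfderiv_comp_apply x hsymm ((e.contMDiffAt_extend he hx).mdifferentiableAt hn) v
  rw [hinv.mfderiv_eq, mfderiv_id] at hcomp
  exact hcomp.symm

lemma disjoint_ker_mfderiv_ker_mfderiv_fibreCoord (hn : n ≠ 0)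
    (h : IsSubmersionAtOfComplement F I J n f x) :
    Disjoint (mfderiv I J f x).ker (mfderiv I 𝓘(𝕜, F) (fibreCoord h) x).ker := by
  rw [Submodule.disjoint_def]
  intro v hfv hqv
  set φ := h.domChart.extend I
  set ψ := h.codChart.extend J
  have hφ : MDifferentiableAt I 𝓘(𝕜, E) φ x :=
    (h.domChart.contMDiffAt_extend h.domChart_mem_maximalAtlas
      h.mem_domChart_source).mdifferentiableAt hn
  have hψ : MDifferentiableAt J 𝓘(𝕜, E') ψ (f x) :=
    (h.codChart.contMDiffAt_extend h.codChart_mem_maximalAtlas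
      h.mem_codChart_source).mdifferentiableAt hn
  have hφv : h.equiv (mfderiv I 𝓘(𝕜, E) φ x v) = 0 := by
    refine Prod.ext ?_ ?_
    · let L : E →L[𝕜] E' := (ContinuousLinearMap.fst 𝕜 E' F).comp h.equiv.toContinuousLinearMap
      have hbase : L ∘ φ =ᶠ[𝓝 x] ψ ∘ f := by
        filter_upwards [h.domChart.open_source.mem_nhds h.mem_domChart_source] with y hy
        exact congrArg Prod.fst (equiv_extend_eq h hy)
      exact (mfderiv_continuousLinearMap_comp_apply hφ L v).symm.trans <|
        (DFunLike.congr_fun hbase.mfderiv_eq v).trans <|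
        (mfderiv_comp_apply x hψ (h.contMDiffAt.mdifferentiableAt hn) v).trans <|
        (congrArg (mfderiv J 𝓘(𝕜, E') ψ (f x)) hfv).trans (map_zero _)
    · let L : E →L[𝕜] F := (ContinuousLinearMap.snd 𝕜 E' F).comp h.equiv.toContinuousLinearMap
      exact (mfderiv_continuousLinearMap_comp_apply hφ L v).symm.trans hqv
  refine mfderiv_extend_injective hn h.domChart_mem_maximalAtlas h.mem_domChart_source ?_
  rw [map_zero]
  exact h.equiv.map_eq_zero_iff.1 hφv

lemma finrank_ker_mfderiv_le
    {E : Type*} [NormedAddCommGroup E] [NormedSpace ℝ E] [FiniteDimensional ℝ E]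
    {E' : Type*} [NormedAddCommGroup E'] [NormedSpace ℝ E']
    {H : Type*} [TopologicalSpace H] {I : ModelWithCorners ℝ E H} [I.Boundaryless]
    {H' : Type*} [TopologicalSpace H'] {J : ModelWithCorners ℝ E' H'}
    {X : Type*} [TopologicalSpace X] [ChartedSpace H X]
    {X' : Type*} [TopologicalSpace X'] [ChartedSpace H' X'] {f : X → X'} {x : X}
    {E₀ : Type*} [NormedAddCommGroup E₀] [NormedSpace ℝ E₀] [FiniteDimensional ℝ E₀]
    {H₀ : Type*} [TopologicalSpace H₀] {I₀ : ModelWithCorners ℝ E₀ H₀} [I₀.Boundaryless]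
    {Y : Type*} [TopologicalSpace Y] [ChartedSpace H₀ Y]
    (hn : n ≠ 0) (hf : IsSubmersionAt I J n f x) {c : Y → X} {y : Y} (hc : ContMDiffAt I₀ I n c y)
    (hcy : c y = x) (hcf : 𝓝[f ⁻¹' {f x}] x ≤ map c (𝓝 y)) :
    Module.finrank ℝ (mfderiv I J f x).ker ≤ Module.finrank ℝ E₀ := by
  obtain ⟨F, _, _, h⟩ := hf
  have : FiniteDimensional ℝ (E' × F) := h.equiv.toLinearEquiv.finiteDimensional
  have : FiniteDimensional ℝ F :=
    Module.Finite.of_surjective (LinearMap.snd ℝ E' F) LinearMap.snd_surjective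
  have : FiniteDimensional ℝ (TangentSpace I x) := inferInstanceAs (FiniteDimensional ℝ E)
  subst hcy
  calc Module.finrank ℝ (mfderiv I J f (c y)).ker
      ≤ Module.finrank ℝ F := LinearMap.finrank_le_finrank_of_injective <|
        LinearMap.injective_domRestrict_iff.2
          (disjoint_ker_mfderiv_ker_mfderiv_fibreCoord hn h)
    _ ≤ Module.finrank ℝ E₀ := by
      refine finrank_le_of_nhds_le_map (f := fibreCoord h ∘ c) (x := y)
        (((contMDiffAt_fibreCoord h).comp y hc).of_le (ENat.one_le_iff_ne_zero_withTop.2 hn)) ?_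
      exact (nhds_fibreCoord_le_map h).trans ((map_mono hcf).trans_eq map_map)

end Submersion

section ProperAction

open MulAction
open scoped Pointwise

variable {G : Type*} [Group G] [TopologicalSpace G]
  {X : Type*} [TopologicalSpace X] [MulAction G X] [ProperSMul G X] [T1Space X]

lemma isClosedMap_smul_point (x : X) : IsClosedMap (fun g : G => g • x) := by
  intro K hK
  have hgraph := (ProperSMul.isProperMap_smul_pair.isClosedMap _
    (hK.prod (isClosed_singleton (x := x)))).preimage (Continuous.prodMk_left x)
  convert! hgraph using 1
  ext y
  simp

lemma nhdsWithin_orbit_le_map_smul_nhds_one [ContinuousMul G] (x : X) :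
    𝓝[orbit G x] x ≤ map (fun g : G => g • x) (𝓝 1) := by
  intro A hA
  obtain ⟨N, hNA, hN, h1N⟩ := mem_nhds_iff.1 hA
  have hclosed : IsClosed ((fun g : G => g • x) '' (N * (stabilizer G x : Set G))ᶜ) :=
    isClosedMap_smul_point x _ hN.mul_right.isClosed_compl
  have hx : x ∉ (fun g : G => g • x) '' (N * (stabilizer G x : Set G))ᶜ := by
    rintro ⟨g, hg, hgx⟩
    exact hg ⟨1, h1N, g, hgx, one_mul g⟩
  filter_upwards [self_mem_nhdsWithin,
    mem_nhdsWithin_of_mem_nhds (hclosed.isOpen_compl.mem_nhds hx)]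
  rintro _ ⟨g, rfl⟩ hg
  obtain ⟨k, hk, s, hs, rfl⟩ : g ∈ (N * (stabilizer G x : Set G)) := by
    by_contra hgN
    exact hg ⟨g, hgN, rfl⟩
  have hksx : (k * s) • x = k • x := by rw [mul_smul, show s • x = x from hs]
  exact mem_of_eq_of_mem hksx (hNA hk)

end ProperAction

section FundamentalField

variable {𝕜 : Type*} [NontriviallyNormedField 𝕜]
  {E : Type*} [NormedAddCommGroup E] [NormedSpace 𝕜 E]
  {H : Type*} [TopologicalSpace H] (I : ModelWithCorners 𝕜 E H)
  {E' : Type*} [NormedAddCommGroup E'] [NormedSpace 𝕜 E']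
  {H' : Type*} [TopologicalSpace H'] (I' : ModelWithCorners 𝕜 E' H')
  {G : Type*} [TopologicalSpace G] [ChartedSpace H G]
  {X : Type*} [TopologicalSpace X] [ChartedSpace H' X]

/-- The fundamental vector field of `α ∈ T₁G` for an action of `G` on `X`. For the action of `G` on
itself by left multiplication, this is the right-invariant vector field of `α`. -/
def fundamentalField [One G] [SMul G X] (α : TangentSpace I (1 : G)) (x : X) :
    TangentSpace I' x :=
  (mfderiv I I' (fun g : G => g • x) 1 α : E')

variable {I I'}

lemma contMDiff_smul_point {n : WithTop ℕ∞} [SMul G X] [ContMDiffSMul I I' n G X] (x : X) :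
    ContMDiff I I' n (fun g : G => g • x) :=
  (contMDiff_smul (I := I) (I' := I')).comp (contMDiff_id.prodMk contMDiff_const)

lemma mfderiv_smul_apply [SMul G X] [ContMDiffSMul I I' 1 G X] (g : G) (x : X)
    (v : TangentSpace I g) (w : TangentSpace I' x) :
    mfderiv (I.prod I') I' (fun y : G × X => y.1 • y.2) (g, x) ((v, w) : E × E') =
      mfderiv I I' (fun h : G => h • x) g v + mfderiv I' I' (fun y : X => g • y) x w :=
  mfderiv_prod_eq_add_apply (p := (g, x)) (v := ((v, w) : E × E'))
    ((contMDiff_smul (I := I) (I' := I')).mdifferentiableAt one_ne_zero)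

lemma fundamentalField_one [Monoid G] (α : TangentSpace I (1 : G)) :
    fundamentalField I I α (1 : G) = α := by
  have h : (fun g : G => g • (1 : G)) = id := funext mul_one
  rw [fundamentalField, h, mfderiv_id]
  rfl

lemma contMDiff_fundamentalField [Monoid G] [MulAction G X] [IsManifold I ∞ G]
    [IsManifold I' ∞ X] [ContMDiffSMul I I' ∞ G X] (α : TangentSpace I (1 : G)) :
    ContMDiff I' I'.tangent ∞
      (fun x : X => (⟨x, fundamentalField I I' α x⟩ : TangentBundle I' X)) := by
  have hsection : ContMDiff I' (I.prod I').tangent ∞ (fun x : X =>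
      (equivTangentBundleProd I G I' X).symm (⟨1, α⟩, ⟨x, 0⟩)) :=
    contMDiff_equivTangentBundleProd_symm.comp
      (contMDiff_const.prodMk (Bundle.contMDiff_zeroSection 𝕜 (TangentSpace I')))
  have hsmul := (contMDiff_smul (I := I) (I' := I') (n := ∞) (G := G)
    (M := X)).contMDiff_tangentMap (m := ∞) (by simp)
  refine (hsmul.comp hsection).congr fun x => ?_
  have hderiv := (mfderiv_smul_apply (1 : G) x α (0 : TangentSpace I' x)).trans
    ((congrArg _ (map_zero _)).trans (add_zero _))
  exact (congrArg (fun y : X => (⟨y, fundamentalField I I' α x⟩ : TangentBundle I' X))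
    (one_smul G x).symm).trans
    (congrArg (fun e : E' => (⟨(1 : G) • x, e⟩ : TangentBundle I' X)) hderiv.symm)

section Group

variable [Group G]

lemma mfderiv_smul_point_fundamentalField [ContMDiffMul I 1 G] [MulAction G X]
    [ContMDiffSMul I I' 1 G X] (α : TangentSpace I (1 : G)) (g : G) (x : X) :
    mfderiv I I' (fun h : G => h • x) g (fundamentalField I I α g) =
      fundamentalField I I' α (g • x) := by
  have hcomp : (fun h : G => h • x) ∘ (fun h : G => h • g) = fun h : G => h • g • x :=
    funext fun h => mul_smul h g x
  have h := mfderiv_comp_apply_of_eq (x := (1 : G))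
    ((contMDiff_smul_point (I := I) (I' := I') (n := 1) x g).mdifferentiableAt one_ne_zero)
    ((contMDiff_smul_point (I := I) (I' := I) (n := 1) g 1).mdifferentiableAt one_ne_zero)
    (one_smul G g) α
  rw [hcomp] at h
  exact h.symm

lemma exists_fundamentalField_eq [ContMDiffMul I 1 G] (g : G) (v : TangentSpace I g) :
    ∃ α : TangentSpace I (1 : G), fundamentalField I I α g = v := by
  have hcomp : (fun h : G => h • g) ∘ (fun h : G => h * g⁻¹) = id :=
    funext fun h => inv_mul_cancel_right h g
  refine ⟨(mfderiv I I (fun h : G => h * g⁻¹) g v : E), ?_⟩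
  have h := mfderiv_comp_apply_of_eq (x := g)
    ((contMDiff_smul_point (I := I) (I' := I) (n := 1) g 1).mdifferentiableAt one_ne_zero)
    ((contMDiff_mul_right (I := I) (n := 1) (a := g⁻¹) g).mdifferentiableAt one_ne_zero)
    (mul_inv_cancel g) v
  rw [hcomp, mfderiv_id] at h
  exact h.symm

end Group

end FundamentalField

section LocallyFreeAction

variable {EG : Type*} [NormedAddCommGroup EG] [NormedSpace ℝ EG]
  {HG : Type*} [TopologicalSpace HG] {I : ModelWithCorners ℝ EG HG}
  {G : Type*} [Group G] [TopologicalSpace G] [ChartedSpace HG G] [LieGroup I ∞ G]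
  {E : Type*} [NormedAddCommGroup E] [NormedSpace ℝ E]
  {H : Type*} [TopologicalSpace H] {I' : ModelWithCorners ℝ E H}
  {X : Type*} [TopologicalSpace X] [ChartedSpace H X] [MulAction G X]
  {α : GroupLieAlgebra I G} {x : X}

lemma isMIntegralCurveAt_smul_point [ContMDiffSMul I I' 1 G X] {γ : ℝ → G} {t : ℝ}
    (hγ : IsMIntegralCurveAt γ (fundamentalField I I α) t) :
    IsMIntegralCurveAt (fun s => γ s • x) (fundamentalField I I' α) t := by
  filter_upwards [hγ] with s hs
  refine (((contMDiff_smul_point (I := I) (I' := I') (n := 1) x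
    (γ s)).mdifferentiableAt one_ne_zero).hasMFDerivAt.comp s hs).congr_mfderiv ?_
  ext
  exact (map_smul (mfderiv I I' (fun g : G => g • x) (γ s)) (1 : ℝ) _).trans
    (congrArg ((1 : ℝ) • ·) (mfderiv_smul_point_fundamentalField α (γ s) x))

lemma eq_zero_of_isMIntegralCurveAt_of_eventually_eq {v : ∀ x : X, TangentSpace I' x} {γ : ℝ → X}
    {t : ℝ} (hγ : IsMIntegralCurveAt γ v t) (hx : γ =ᶠ[𝓝 t] fun _ => x) : v x = 0 := by
  have hderiv := hγ.self_of_nhds.mfderiv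
  rw [hx.mfderiv_eq, mfderiv_const, hx.self_of_nhds] at hderiv
  exact (one_smul ℝ (v x)).symm.trans (DFunLike.congr_fun hderiv (1 : ℝ)).symm

variable [I.Boundaryless] [I'.Boundaryless] [CompleteSpace EG]
  [IsManifold I' ∞ X] [ContMDiffSMul I I' ∞ G X]

lemma eq_zero_of_fundamentalField_eq_zero (hx : ∀ᶠ g : G in 𝓝 1, g • x = x → g = 1)
    (hα : fundamentalField I I' α x = 0) : α = 0 := by
  obtain ⟨γ, hγ₀, hγ⟩ := exists_isMIntegralCurveAt_of_contMDiffAt_boundaryless (t₀ := 0)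
    ((contMDiff_fundamentalField (I' := I) α (1 : G)).of_le (by simp))
  have hfix : (fun t => γ t • x) =ᶠ[𝓝 0] fun _ => x :=
    isMIntegralCurveAt_eventuallyEq_of_contMDiffAt_boundaryless
      ((contMDiff_fundamentalField (I' := I') α _).of_le (by simp))
      (isMIntegralCurveAt_smul_point hγ)
      ((isMIntegralCurve_const hα).isMIntegralCurveAt 0) (by simp [hγ₀])
  have hγ_one : γ =ᶠ[𝓝 0] fun _ => 1 := by
    have hcont : Tendsto γ (𝓝 0) (𝓝 1) := hγ₀ ▸ hγ.continuousAt
    filter_upwards [hfix, hcont.eventually hx] with t ht ht'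
    exact ht' ht
  rw [← fundamentalField_one α]
  exact eq_zero_of_isMIntegralCurveAt_of_eventually_eq hγ hγ_one

end LocallyFreeAction

section Bundle

variable {EG : Type*} [NormedAddCommGroup EG] [NormedSpace ℝ EG]
  {G : Type*} [Group G] [TopologicalSpace G] [ChartedSpace EG G]
  {EM : Type*} [NormedAddCommGroup EM] [NormedSpace ℝ EM]
  {M : Type*} [TopologicalSpace M] [ChartedSpace EM M]

namespace PrincipalBundle

variable (P : PrincipalBundle.{u, v} EG G EM M)

lemma dAct_surjective (g : G) (p : P) : Function.Surjective (P.dAct g p) := by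
  intro w
  have hsmul (h : G) (q : P) : MDifferentiableAt 𝓘(ℝ, P.E) 𝓘(ℝ, P.E) (fun q : P => h • q) q :=
    (P.smooth_action.contMDiff_smul.comp (contMDiff_const.prodMk contMDiff_id) q).mdifferentiableAt
      (by simp)
  have hcomp : (fun q : P => g • q) ∘ (fun q : P => g⁻¹ • q) = id := funext (smul_inv_smul g)
  refine ⟨(P.dAct g⁻¹ (g • p) w : P.E), ?_⟩
  have h := mfderiv_comp_apply_of_eq (x := g • p) (hsmul g p) (hsmul g⁻¹ (g • p))
    (inv_smul_smul g p) w
  rw [hcomp, mfderiv_id] at h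
  exact h.symm

lemma preimage_π_singleton (p : P) : P.π ⁻¹' {P.π p} = MulAction.orbit G p := by
  ext q
  constructor
  · intro hq
    obtain ⟨g, rfl⟩ := P.transitive p q (Eq.symm hq)
    exact MulAction.mem_orbit p g
  · rintro ⟨g, rfl⟩
    exact P.invariant_π g p

lemma fundamental_mem_vertical (α : GroupLieAlgebra 𝓘(ℝ, EG) G) (p : P) :
    P.fundamental α p ∈ P.vertical p := by
  have hconst : P.π ∘ (fun g : G => g • p) = fun _ => P.π p := funext fun g => P.invariant_π g p
  have hπ := (P.submersion_π.isSubmersionAt p).contMDiffAt.mdifferentiableAt (by simp)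
  have h := mfderiv_comp_apply_of_eq (x := (1 : G)) hπ
    ((contMDiff_smul_point (I := 𝓘(ℝ, EG)) (I' := 𝓘(ℝ, P.E)) (n := ∞) p 1).mdifferentiableAt
      (by simp)) (one_smul G p) α
  rw [hconst, mfderiv_const] at h
  exact h.symm

variable [LieGroup 𝓘(ℝ, EG) ∞ G] [FiniteDimensional ℝ EG]

lemma finrank_vertical_le (p : P) :
    Module.finrank ℝ (P.vertical p) ≤ Module.finrank ℝ EG := by
  have : IsTopologicalGroup G := topologicalGroup_of_lieGroup 𝓘(ℝ, EG) ∞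
  refine finrank_ker_mfderiv_le (n := ∞) (by simp) (P.submersion_π.isSubmersionAt p)
    (contMDiff_smul_point (I := 𝓘(ℝ, EG)) p 1) (one_smul G p) ?_
  rw [preimage_π_singleton]
  exact nhdsWithin_orbit_le_map_smul_nhds_one p

lemma fundamental_injective (p : P) :
    Function.Injective (mfderiv 𝓘(ℝ, EG) 𝓘(ℝ, P.E) (fun g : G => g • p) 1) := by
  have : CompleteSpace EG := FiniteDimensional.complete ℝ EG
  exact (injective_iff_map_eq_zero _).2 fun α => eq_zero_of_fundamentalField_eq_zero
    (.of_forall fun g => P.free g p)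

lemma exists_fundamental_eq_of_mem_vertical {p : P} {w : P.T p} (hw : w ∈ P.vertical p) :
    ∃ α : GroupLieAlgebra 𝓘(ℝ, EG) G, P.fundamental α p = w := by
  have : FiniteDimensional ℝ (P.T p) := inferInstanceAs (FiniteDimensional ℝ P.E)
  let orbitDeriv : EG →ₗ[ℝ] P.T p :=
    (mfderiv 𝓘(ℝ, EG) 𝓘(ℝ, P.E) (fun g : G => g • p) 1 : EG →L[ℝ] P.E).toLinearMap
  have hinj : Function.Injective orbitDeriv := P.fundamental_injective p
  have hle : orbitDeriv.range ≤ P.vertical p := by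
    rintro _ ⟨α, rfl⟩
    exact P.fundamental_mem_vertical α p
  have heq : orbitDeriv.range = P.vertical p := by
    refine Submodule.eq_of_le_of_finrank_le hle ?_
    rw [LinearMap.finrank_range_of_inj hinj]
    exact P.finrank_vertical_le p
  rw [← heq] at hw
  exact hw

end PrincipalBundle

end Bundle

section PfaffianGroups

lemma kerToPoint_eq_top {E : Type*} [NormedAddCommGroup E] [NormedSpace ℝ E]
    {X : Type*} [TopologicalSpace X] [ChartedSpace E X] (x : X) :
    kerToPoint (E := E) x = ⊤ := by
  rw [kerToPoint, mfderiv_const]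
  exact LinearMap.ker_zero

variable {EG : Type*} [NormedAddCommGroup EG] [NormedSpace ℝ EG]
  {G : Type*} [Group G] [TopologicalSpace G] [ChartedSpace EG G] [LieGroup 𝓘(ℝ, EG) ∞ G]
  {V : Type*} [NormedAddCommGroup V] [NormedSpace ℝ V]

namespace PfaffianGroup

variable (A : PfaffianGroup EG G V) {α β : GroupLieAlgebra 𝓘(ℝ, EG) G}

lemma form_fundamentalField (α : GroupLieAlgebra 𝓘(ℝ, EG) G) (g : G) :
    A.form g (fundamentalField 𝓘(ℝ, EG) 𝓘(ℝ, EG) α g) = A.l α := by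
  have h := A.multiplicative 1 g α (0 : TangentSpace 𝓘(ℝ, EG) g)
  have hderiv := (mfderiv_smul_apply (1 : G) g α (0 : TangentSpace 𝓘(ℝ, EG) g)).trans
    ((congrArg _ (map_zero _)).trans (add_zero _))
  rw [map_zero, map_zero, add_zero] at h
  exact (congrArg (fun k : G => (A.form k : EG → V) (fundamentalField 𝓘(ℝ, EG) 𝓘(ℝ, EG) α g))
    (one_mul g).symm).trans ((congrArg (A.form (1 * g)) hderiv.symm).trans h)

lemma extDerivForm_form_one [FiniteDimensional ℝ EG] (hα : A.l α = 0) (hβ : A.l β = 0) :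
    extDerivForm A.form 1 ![α, β] = 0 := by
  have hker {γ : GroupLieAlgebra 𝓘(ℝ, EG) G} (hγ : A.l γ = 0) (g : G) :
      fundamentalField 𝓘(ℝ, EG) 𝓘(ℝ, EG) γ g ∈ (A.form g).ker :=
    (A.form_fundamentalField γ g).trans hγ
  have hsymbol {γ : GroupLieAlgebra 𝓘(ℝ, EG) G} (hγ : A.l γ = 0) (g : G) :
      fundamentalField 𝓘(ℝ, EG) 𝓘(ℝ, EG) γ g ∈ (A.form g).ker ⊓ kerToPoint g :=
    ⟨hker hγ g, kerToPoint_eq_top (E := EG) g ▸ Submodule.mem_top⟩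
  have hsmooth (γ : GroupLieAlgebra 𝓘(ℝ, EG) G) :
      IsSmoothFieldOn (fundamentalField 𝓘(ℝ, EG) 𝓘(ℝ, EG) γ) (univ : Set G) :=
    (contMDiff_fundamentalField γ).contMDiffOn
  have hbracket := (A.symbol_involutive univ isOpen_univ _ _ (hsmooth α) (hsmooth β)
    (fun g _ => hsymbol hα g) (fun g _ => hsymbol hβ g) 1 (mem_univ 1)).1
  have hcartan := apply_mlieBracket_eq_neg_extDerivForm A.smooth_form (x := (1 : G)) univ_mem
    (hsmooth α) (hsmooth β) (fun g _ => hker hα g) fun g _ => hker hβ g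
  rw [fundamentalField_one, fundamentalField_one] at hcartan
  exact neg_eq_zero.1 (hcartan.symm.trans hbracket)

end PfaffianGroup

end PfaffianGroups

section Equivalence

variable {EG : Type*} [NormedAddCommGroup EG] [NormedSpace ℝ EG]
  {G : Type*} [Group G] [TopologicalSpace G] [ChartedSpace EG G] [LieGroup 𝓘(ℝ, EG) ∞ G]
  {V : Type*} [NormedAddCommGroup V] [NormedSpace ℝ V]
  {EM : Type*} [NormedAddCommGroup EM] [NormedSpace ℝ EM]
  {M : Type*} [TopologicalSpace M] [ChartedSpace EM M]
  {A : PfaffianGroup EG G V} {P : PrincipalBundle.{u, v} EG G EM M}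

lemma ker_eq_comap_dAct {θ : ∀ p : P, P.T p →L[ℝ] V} (hθ : IsEquivariantForm A P θ) (g : G)
    (p : P) :
    (θ p).ker = (θ (g • p)).ker.comap (P.dAct g p : P.T p →ₗ[ℝ] P.T (g • p)) := by
  ext w
  have hρ : A.ρ g (θ p w) = 0 ↔ θ p w = 0 :=
    (Function.LeftInverse.injective (A.ρ.inv_self_apply g)).eq_iff' (map_zero _)
  exact hρ.symm.trans (by rw [← hθ g p w]; rfl)

namespace FullPfaffian

variable (S : FullPfaffian A P)

lemma apply_mfderiv_smul_point (p : P) (g : G) (v : TangentSpace 𝓘(ℝ, EG) g) :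
    S.θ (g • p) (mfderiv 𝓘(ℝ, EG) 𝓘(ℝ, P.E) (fun h : G => h • p) g v) = A.form g v := by
  have h := S.multiplicative g p v (0 : P.T p)
  rwa [mfderiv_smul_apply, map_zero, map_zero, map_zero, add_zero, add_zero] at h

lemma equivariant : IsEquivariantForm A P S.θ := by
  intro g p w
  have h := S.multiplicative g p (0 : TangentSpace 𝓘(ℝ, EG) g) w
  rwa [mfderiv_smul_apply, map_zero, map_zero, zero_add, zero_add] at h

lemma apply_fundamental (α : GroupLieAlgebra 𝓘(ℝ, EG) G) (p : P) :
    S.θ p (P.fundamental α p) = A.l α :=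
  (congrArg (fun q : P => (S.θ q : P.E → V) (P.fundamental α p)) (one_smul G p).symm).trans
    (S.apply_mfderiv_smul_point p 1 α)

lemma ker_vertical (p : P) : (S.θ p).ker ≤ P.vertical p := by
  have h := S.moment_projection p
  rw [kerToPoint_eq_top, top_inf_eq] at h
  exact inf_eq_right.1 h.symm

lemma extDerivForm_fundamental [FiniteDimensional ℝ EG] {α β : GroupLieAlgebra 𝓘(ℝ, EG) G}
    (hα : A.l α = 0) (hβ : A.l β = 0) (p : P) :
    extDerivForm S.θ p ![P.fundamental α p, P.fundamental β p] = 0 := by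
  have hpullback := DFunLike.congr_fun (extDerivForm_pullback (x := (1 : G)) S.smooth
    (contMDiff_smul_point p) fun g => ContinuousLinearMap.ext fun v =>
      (S.apply_mfderiv_smul_point p g v).symm) ![α, β]
  have hpair : (fun i => mfderiv 𝓘(ℝ, EG) 𝓘(ℝ, P.E) (fun g : G => g • p) 1 (![α, β] i) :
      Fin 2 → P.E) = ![P.fundamental α p, P.fundamental β p] := by
    ext i
    fin_cases i <;> rfl
  have hbase : (extDerivForm S.θ p : (Fin 2 → P.E) → V) ![P.fundamental α p, P.fundamental β p] =
      (extDerivForm S.θ ((1 : G) • p) : (Fin 2 → P.E) → V)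
        ![P.fundamental α p, P.fundamental β p] := by
    rw [one_smul]
  exact hbase.trans ((congrArg _ hpair.symm).trans
    (hpullback.symm.trans (A.extDerivForm_form_one hα hβ)))

lemma ker_involutive [FiniteDimensional ℝ EG] : IsInvolutive fun p : P => (S.θ p).ker := by
  refine isInvolutive_ker S.smooth fun p v hv w hw => ?_
  obtain ⟨α, rfl⟩ := P.exists_fundamental_eq_of_mem_vertical (S.ker_vertical p hv)
  obtain ⟨β, rfl⟩ := P.exists_fundamental_eq_of_mem_vertical (S.ker_vertical p hw)
  exact S.extDerivForm_fundamental ((S.apply_fundamental α p).symm.trans hv)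
    ((S.apply_fundamental β p).symm.trans hw) p

/-- The full principal Pfaffian bundle `S`, seen as an equivariant form with involutive vertical
kernel. -/
def toFormData [FiniteDimensional ℝ EG] : FormData A P where
  θ := S.θ
  smooth := S.smooth
  surjective := S.full
  equivariant := S.equivariant
  ker_involutive := S.ker_involutive
  ker_vertical := S.ker_vertical
  fundamental := S.apply_fundamental

end FullPfaffian

namespace FormData

variable (S : FormData A P)

/-- The full principal Pfaffian bundle with the same form as `S`. -/
def toFullPfaffian : FullPfaffian A P where
  θ := S.θ
  smooth := S.smooth
  multiplicative g p v w := by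
    obtain ⟨α, rfl⟩ := exists_fundamentalField_eq g v
    rw [mfderiv_smul_apply, map_add, mfderiv_smul_point_fundamentalField, A.form_fundamentalField]
    exact congrArg₂ (· + ·) (S.fundamental α (g • p)) (S.equivariant g p w)
  moment_projection p := by
    rw [kerToPoint_eq_top, top_inf_eq]
    exact (inf_eq_right.2 (S.ker_vertical p)).symm
  full := S.surjective

/-- The foliation tangent to the kernel of the form, with the isomorphism of its normal bundle
induced by the form. -/
def toFoliationData [FiniteDimensional ℝ V] : FoliationData A P where
  F :=
    { tangent := fun p => (S.θ p).ker
      regular := isRegularDistribution_ker S.smooth S.surjective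
      involutive := S.ker_involutive }
  F_equivariant g p :=
    (congrArg (Submodule.map (P.dAct g p : P.T p →ₗ[ℝ] P.T (g • p)))
      (ker_eq_comap_dAct S.equivariant g p)).trans
      (Submodule.map_comap_eq_of_surjective (P.dAct_surjective g p) _)
  F_vertical := S.ker_vertical
  Φ p := (S.θ p : P.T p →ₗ[ℝ] V).quotKerEquivOfSurjective (S.surjective p)
  Φ_smooth := S.smooth
  Φ_equivariant := S.equivariant
  Φ_fundamental := S.fundamental

end FormData

namespace FoliationData

/-- The form `Φ ∘ [·]` defined by a foliation with a trivialization of its normal bundle. -/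
def form (D : FoliationData A P) (p : P) : P.T p →L[ℝ] V :=
  (LinearMap.toContinuousLinearMap
    ((D.Φ p : (P.T p ⧸ D.F.tangent p) →ₗ[ℝ] V) ∘ₗ (D.F.tangent p).mkQ : P.E →ₗ[ℝ] V) :
    P.E →L[ℝ] V)

lemma ker_form (D : FoliationData A P) (p : P) : (D.form p).ker = D.F.tangent p := by
  ext w
  change D.Φ p ((D.F.tangent p).mkQ w) = 0 ↔ w ∈ D.F.tangent p
  rw [LinearEquiv.map_eq_zero_iff, Submodule.mkQ_apply, Submodule.Quotient.mk_eq_zero]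

/-- The equivariant form with involutive vertical kernel defined by a foliation with a
trivialization of its normal bundle. -/
def toFormData (D : FoliationData A P) : FormData A P where
  θ := D.form
  smooth := D.Φ_smooth
  surjective p := (D.Φ p).surjective.comp (D.F.tangent p).mkQ_surjective
  equivariant := D.Φ_equivariant
  ker_involutive := by
    rw [funext D.ker_form]
    exact D.F.involutive
  ker_vertical p := (D.ker_form p).trans_le (D.F_vertical p)
  fundamental := D.Φ_fundamental

lemma eq_of_tangent_of_apply {D D' : FoliationData A P} (hF : D.F.tangent = D'.F.tangent)
    (hΦ : ∀ (p : P) (w : P.T p),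
      D.Φ p ((D.F.tangent p).mkQ w) = D'.Φ p ((D'.F.tangent p).mkQ w)) : D = D' := by
  obtain ⟨⟨T, _, _⟩, _, _, Φ, _, _, _⟩ := D
  obtain ⟨⟨T', _, _⟩, _, _, Φ', _, _, _⟩ := D'
  obtain rfl : T = T' := hF
  obtain rfl : Φ = Φ' := by
    funext p
    ext x
    obtain ⟨w, rfl⟩ := (T p).mkQ_surjective x
    exact hΦ p w
  rfl

end FoliationData

/-- Full principal Pfaffian bundles are the same as equivariant forms with involutive vertical
kernel. -/
def fullPfaffianEquivFormData [FiniteDimensional ℝ EG] (A : PfaffianGroup EG G V)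
    (P : PrincipalBundle.{u, v} EG G EM M) : FullPfaffian A P ≃ FormData A P where
  toFun S := S.toFormData
  invFun S := S.toFullPfaffian
  left_inv _ := rfl
  right_inv _ := rfl

/-- Equivariant forms with involutive vertical kernel are the same as equivariant vertical
foliations with a trivialization of the normal bundle. -/
def formDataEquivFoliationData [FiniteDimensional ℝ V] (A : PfaffianGroup EG G V)
    (P : PrincipalBundle.{u, v} EG G EM M) : FormData A P ≃ FoliationData A P where
  toFun S := S.toFoliationData
  invFun D := D.toFormData
  left_inv _ := rfl
  right_inv D := FoliationData.eq_of_tangent_of_apply (funext D.ker_form) fun _ _ => rfl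

end Equivalence

end Pfaffian

end

theorem mainTheorem7
    {EG : Type*} [NormedAddCommGroup EG] [NormedSpace ℝ EG] [FiniteDimensional ℝ EG]
    {G : Type*} [Group G] [TopologicalSpace G] [ChartedSpace EG G] [LieGroup 𝓘(ℝ, EG) ∞ G]
    [T2Space G]
    {V : Type*} [NormedAddCommGroup V] [NormedSpace ℝ V] [FiniteDimensional ℝ V]
    {EM : Type*} [NormedAddCommGroup EM] [NormedSpace ℝ EM] [FiniteDimensional ℝ EM]
    {M : Type*} [TopologicalSpace M] [ChartedSpace EM M] [IsManifold 𝓘(ℝ, EM) ∞ M] [T2Space M]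
    (A : PfaffianGroup EG G V) :
    (∃ e : ∀ P : PrincipalBundle EG G EM M, FullPfaffian A P ≃ FoliationData A P,
      (∀ P (S : FullPfaffian A P) (p : P), (e P S).F.tangent p = (S.θ p).ker) ∧
      (∀ P (S : FullPfaffian A P) (p : P) (w : P.T p),
        (e P S).Φ p (((e P S).F.tangent p).mkQ w) = S.θ p w) ∧
      (∀ P Q (S : FullPfaffian A P) (S' : FullPfaffian A Q) (Ψ : PrincipalBundle.Hom P Q),
        S.IsMorphism S' Ψ ↔ (e P S).IsMorphism (e Q S') Ψ)) ∧
    (∃ e : ∀ P : PrincipalBundle EG G EM M, FullPfaffian A P ≃ FormData A P,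
      (∀ P (S : FullPfaffian A P) (p : P), (e P S).θ p = S.θ p) ∧
      (∀ P Q (S : FullPfaffian A P) (S' : FullPfaffian A Q) (Ψ : PrincipalBundle.Hom P Q),
        S.IsMorphism S' Ψ ↔ (e P S).IsMorphism (e Q S') Ψ)) := by
  refine ⟨⟨fun P => (fullPfaffianEquivFormData A P).trans (formDataEquivFoliationData A P),
    fun _ _ _ => rfl, fun _ _ _ _ => rfl, fun P Q S S' Ψ => ⟨fun h => ⟨fun p => ?_, h⟩, And.right⟩⟩,
    ⟨fun P => fullPfaffianEquivFormData A P, fun _ _ _ => rfl, fun _ _ _ _ _ => Iff.rfl⟩⟩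
  rintro _ ⟨w, hw, rfl⟩
  exact (h p w).trans hw
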